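/- Let $\Omega\subset\mathbb R^d$ be a measurable set of finite Lebesgue measure, let $1\le n<q$, and let $v_1,\dots,v_q\in\mathbb R^n$ be the (pairwise distinct) vertices of a convex polytope $P=\operatorname{conv}\{v_1,\dots,v_q\}$ with non-empty interior. Let $R:\mathbb R^n\to\mathbb R\cup\{+\infty\}$ be the polytopal Legendre function $$R(x)=\inf\Big\{\sum_{i=1}^q\lambda_i\ln\lambda_i\;\Big|\;\lambda_i\ge 0,\ \sum_{i=1}^q\lambda_i=1,\ \sum_{i=1}^q\lambda_iv_i=x\Big\},\qquad 0\ln 0:=0,\quad \inf\emptyset:=+\infty .$$ Where the subdifferential $\partial R(x)$ is a singleton, $\nabla R(x)$ denotes its element. The Bregman divergence of $R$ is $D_R(p,y)=R(p)-R(y)-\nabla R(y)\cdot(p-y)$. Put $$\mathcal K=\{\eta\in L^\infty(\Omega;\mathbb R^n):\eta(x)\in P\text{ for a.e. }x\},\qquad \mathring{\mathcal K}=\{\eta\in\mathcal K:\operatorname*{ess\,inf}_{x\in\Omega}\operatorname{dist}(\eta(x),\partial P)>0\},$$ and, for a matrix $W\in\mathbb R^{r\times n}$ and $b\in\mathbb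 R^r$, let $\mathcal M=\{\eta\in L^\infty(\Omega;\mathbb R^n):\int_\Omega W\eta\,dx\le b\text{ componentwise}\}$ and $\mathcal A=\mathcal K\cap\mathcal M$. Let $F:L^\infty(\Omega;\mathbb R^n)\to\mathbb R$ and $\nabla F:L^\infty(\Omega;\mathbb R^n)\to L^\infty(\Omega;\mathbb R^n)$. Assume that $F$ is continuously Fréchet differentiable on $\mathcal A$ (it is enough that the derivatives exist relative to $\mathcal A$) and that $\nabla F$ represents its derivative there: $$\int_\Omega\nabla F(\eta)\cdot q\,dx=\langle F'(\eta),q\rangle\qquad\text{for all }\eta\in\mathcal A,\ q\in L^\infty(\Omega;\mathbb R^n).$$ (Nothing is required of $\nabla F$ at points outside $\mathcal A$, apart from its values lying in $L^\infty$.) **Theorem (Interior Evolution).** Let $\alpha>0$ and let $v\in\mathring{\mathcal K}$ with $\nabla R(v)\in L^\infty(\Omega;\mathbb R^n)$. Then the functional $$J(\eta)=\int_\Omega \alpha\,\nabla F(v)\cdot\eta+D_R(\eta,v)\,dx,\qquad \eta\in L^1(\Omega;\mathbb R^n),$$ is well defined with values in $\mathbb R\cup\{+\infty\}$ (its integrand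 is measurable and has integrable negative part), its minimum over $L^1(\Omega;\mathbb R^n)$ is finite and attained at exactly one point $\eta^\star$, and $\eta^\star\in\mathcal K$. Moreover $\eta^\star$ is uniformly bounded away from $\partial P$, that is, $\eta^\star\in\mathring{\mathcal K}$, and $\nabla R(\eta^\star)\in L^\infty(\Omega;\mathbb R^n)$. -/

import Mathlib

open MeasureTheory Set
open scoped ENNReal RealInnerProductSpace

noncomputable section

namespace MirrorDescent

/-- `ℝⁿ` with the Euclidean norm. -/
abbrev E (n : ℕ) := EuclideanSpace ℝ (Fin n)

/-! ### Convex analysis for functions with values in `ℝ ∪ {+∞}` (as `EReal`-valued functions) -/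

/-- The subdifferential of `f` at `x`: all `s` with `s · (y - x) + f x ≤ f y` for every `y`. -/
def subdifferential {n : ℕ} (f : E n → EReal) (x : E n) : Set (E n) :=
  {s | ∀ y : E n, ((⟪s, y - x⟫ : ℝ) : EReal) + f x ≤ f y}

open Classical in
/-- The gradient of `f` at `x`: the unique subgradient if the subdifferential at `x` is a
singleton (and `0` otherwise). -/
def grad {n : ℕ} (f : E n → EReal) (x : E n) : E n :=
  if h : ∃ s, subdifferential f x = {s} then h.choose else 0

/-- The Bregman divergence `f p - f q - ∇f(q) · (p - q)`. -/
def bregman {n : ℕ} (f : E n → EReal) (p q : E n) : EReal :=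
  f p - f q - ((⟪grad f q, p - q⟫ : ℝ) : EReal)

/-! ### The polytope and its Legendre function -/

/-- The polytope `P = conv {V 0, …, V (q-1)}`. -/
def polytope {n q : ℕ} (V : Fin q → E n) : Set (E n) := convexHull ℝ (range V)

/-- The points `V i` are pairwise distinct and are exactly the vertices (extreme points) of the
polytope that they span. -/
def AreVertices {n q : ℕ} (V : Fin q → E n) : Prop :=
  Function.Injective V ∧ (polytope V).extremePoints ℝ = range V

/-- The polytopal Legendre function
`R x = inf {∑ i, lam i * log (lam i) | lam in the standard simplex, ∑ i, lam i • V i = x}`,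
with the conventions `0 log 0 = 0` and `inf ∅ = +∞`. -/
def legendre {n q : ℕ} (V : Fin q → E n) (x : E n) : EReal :=
  ⨅ lam ∈ {lam : Fin q → ℝ | lam ∈ stdSimplex ℝ (Fin q) ∧ ∑ i, lam i • V i = x},
    ((∑ i, lam i * Real.log (lam i) : ℝ) : EReal)

/-! ### The constraint sets in `L^∞(Ω; ℝⁿ)`; `μ` is Lebesgue measure on `Ω` -/

section Sets

variable {X : Type*} [MeasurableSpace X] {n : ℕ}

/-- The set `𝒦` of all `η ∈ L^∞` with `η x ∈ P` for almost every `x`. -/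
def setK (μ : Measure X) (P : Set (E n)) : Set (Lp (E n) ∞ μ) :=
  {η | ∀ᵐ x ∂μ, η x ∈ P}

/-- The set of all `η ∈ 𝒦` whose distance to `∂P` has positive essential infimum. -/
def setKint (μ : Measure X) (P : Set (E n)) : Set (Lp (E n) ∞ μ) :=
  {η | η ∈ setK μ P ∧ 0 < essInf (fun x => Metric.infEDist (η x) (frontier P)) μ}

/-- The set `ℳ` of all `η ∈ L^∞` with `∫ W η ≤ b` componentwise. -/
def setM (μ : Measure X) {r : ℕ} (W : Matrix (Fin r) (Fin n) ℝ) (b : Fin r → ℝ) :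
    Set (Lp (E n) ∞ μ) :=
  {η | ∀ i, ∫ x, (W.mulVec (WithLp.ofLp (η x))) i ∂μ ≤ b i}

/-- `F` is continuously Fréchet differentiable on `A` (derivatives being taken within `A`), and
`gradF` is a primal representation in `L^∞` of the derivative on `A`:
`∫ gradF η · q = ⟨F' η, q⟩` for all `η ∈ A` and `q ∈ L^∞`. -/
def DifferentiableWithPrimalGradient (μ : Measure X) (A : Set (Lp (E n) ∞ μ))
    (F : Lp (E n) ∞ μ → ℝ) (gradF : Lp (E n) ∞ μ → Lp (E n) ∞ μ) : Prop :=
  ∃ F' : Lp (E n) ∞ μ → (Lp (E n) ∞ μ →L[ℝ] ℝ),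
    (∀ η ∈ A, HasFDerivWithinAt F (F' η) A η) ∧ ContinuousOn F' A ∧
    ∀ η ∈ A, ∀ q : Lp (E n) ∞ μ, ∫ x, ⟪gradF η x, q x⟫ ∂μ = F' η q

/-! ### The mirror descent subproblem -/

/-- The integral of an extended real valued function: the integral of the positive part minus the
integral of the negative part. -/
def extIntegral (μ : Measure X) (f : X → EReal) : EReal :=
  ((∫⁻ x, (f x).toENNReal ∂μ : ℝ≥0∞) : EReal) - ((∫⁻ x, (-f x).toENNReal ∂μ : ℝ≥0∞) : EReal)

/-- The integrand `α g(x) · η(x) + D_f(η(x), v(x))`. -/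
def integrand (f : E n → EReal) (α : ℝ) (g v η : X → E n) (x : X) : EReal :=
  ((α * ⟪g x, η x⟫ : ℝ) : EReal) + bregman f (η x) (v x)

/-- The objective `J η = ∫ α g · η + D_f(η, v)`, for `η ∈ L¹`. -/
def objective (μ : Measure X) (f : E n → EReal) (α : ℝ) (g v : Lp (E n) ∞ μ)
    (η : Lp (E n) 1 μ) : EReal :=
  extIntegral μ (integrand f α g v η)

end Sets

end MirrorDescent

end

noncomputable section

namespace MirrorDescent

variable {n q : ℕ}

/-! `R` is the convex conjugate of the log-partition function `A s = log (∑ i, exp (s · V i))`, and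
the problem decouples pointwise. With `s = ∇R(v) - α g`, the integrand is `R(η) - s · η` plus a term
independent of `η`. By Fenchel-Young it is at least `minIntegrand`, with equality only at `gibbsMean
V s`. So the minimizer is explicit and no compactness in function space is needed.

The inequality and its equality case come from `entropy_eq_add_sum_klFun`: the gap is a sum of
nonnegative relative-entropy terms. Since `s` is essentially bounded, its Gibbs means stay in a
compact subset of the interior of `P` (`exists_le_infEDist_gibbsMean`). Finally `∇R (gibbsMean V s)
= s` (`grad_gibbsMean`) bounds the gradient at the minimizer. -/

/-- The entropy `∑ i, lam i * log (lam i)`. -/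
def entropy (lam : Fin q → ℝ) : ℝ := ∑ i, lam i * Real.log (lam i)

/-- The partition function `∑ i, exp (s · V i)`. -/
def partition (V : Fin q → E n) (s : E n) : ℝ := ∑ i, Real.exp ⟪s, V i⟫

/-- The Gibbs weights `exp (s · V i) / ∑ j, exp (s · V j)`. -/
def gibbs (V : Fin q → E n) (s : E n) (i : Fin q) : ℝ := Real.exp ⟪s, V i⟫ / partition V s

/-- The mean of the Gibbs weights, which is the gradient of `log (partition V)`. -/
def gibbsMean (V : Fin q → E n) (s : E n) : E n := ∑ i, gibbs V s i • V i

lemma continuous_entropy : Continuous (entropy : (Fin q → ℝ) → ℝ) :=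
  continuous_finsetSum _ fun i _ => Real.continuous_mul_log.comp (continuous_apply i)

lemma continuous_partition (V : Fin q → E n) : Continuous (partition V) := by
  unfold partition; fun_prop

/-! ### Gibbs weights and relative entropy -/

section Gibbs

variable [NeZero q] (V : Fin q → E n)

lemma partition_pos (s : E n) : 0 < partition V s :=
  Finset.sum_pos (fun _ _ => Real.exp_pos _) Finset.univ_nonempty

lemma gibbs_pos (s : E n) (i : Fin q) : 0 < gibbs V s i :=
  div_pos (Real.exp_pos _) (partition_pos V s)

lemma sum_gibbs (s : E n) : ∑ i, gibbs V s i = 1 := by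
  simp only [gibbs, ← Finset.sum_div]
  exact div_self (partition_pos V s).ne'

lemma gibbs_mem_stdSimplex (s : E n) : gibbs V s ∈ stdSimplex ℝ (Fin q) :=
  ⟨fun i => (gibbs_pos V s i).le, sum_gibbs V s⟩

lemma log_gibbs (s : E n) (i : Fin q) :
    Real.log (gibbs V s i) = ⟪s, V i⟫ - Real.log (partition V s) := by
  rw [gibbs, Real.log_div (Real.exp_pos _).ne' (partition_pos V s).ne', Real.log_exp]

lemma continuous_log_partition : Continuous fun s => Real.log (partition V s) :=
  (continuous_partition V).log fun s => (partition_pos V s).ne'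

lemma continuous_gibbsMean : Continuous (gibbsMean V) := by
  refine continuous_finsetSum _ fun i _ => Continuous.smul (f := fun s => gibbs V s i) ?_
    continuous_const
  exact Continuous.div (by fun_prop) (continuous_partition V) fun s => (partition_pos V s).ne'

/-- The Gibbs variational identity. -/
lemma entropy_eq_add_sum_klFun (s : E n) {lam : Fin q → ℝ} (hlam : lam ∈ stdSimplex ℝ (Fin q)) :
    entropy lam = ⟪s, ∑ i, lam i • V i⟫ - Real.log (partition V s) +
      ∑ i, gibbs V s i * InformationTheory.klFun (lam i / gibbs V s i) := by
  -- The trailing `- gibbs V s i + lam i` offsets the affine part of `klFun` and sums to zero, both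
  -- weight vectors having total mass one.
  have key : ∀ i, lam i * Real.log (lam i) = lam i * ⟪s, V i⟫ - lam i * Real.log (partition V s) +
      gibbs V s i * InformationTheory.klFun (lam i / gibbs V s i) - gibbs V s i + lam i := by
    intro i
    have hg := gibbs_pos V s i
    rcases eq_or_ne (lam i) 0 with h | h
    · simp [h, InformationTheory.klFun_zero]
    · rw [InformationTheory.klFun_apply, Real.log_div h hg.ne', log_gibbs]
      field_simp
      ring
  simp only [entropy, inner_sum, inner_smul_right]
  rw [Finset.sum_congr rfl fun i _ => key i]
  simp only [Finset.sum_add_distrib, Finset.sum_sub_distrib, sum_gibbs, ← Finset.sum_mul, hlam.2]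
  ring

lemma gibbs_mul_klFun_nonneg (s : E n) {lam : Fin q → ℝ} (hlam : lam ∈ stdSimplex ℝ (Fin q))
    (i : Fin q) : 0 ≤ gibbs V s i * InformationTheory.klFun (lam i / gibbs V s i) :=
  mul_nonneg (gibbs_pos V s i).le
    (InformationTheory.klFun_nonneg (div_nonneg (hlam.1 i) (gibbs_pos V s i).le))

lemma inner_sub_log_partition_le_entropy (s : E n) {lam : Fin q → ℝ}
    (hlam : lam ∈ stdSimplex ℝ (Fin q)) :
    ⟪s, ∑ i, lam i • V i⟫ - Real.log (partition V s) ≤ entropy lam := by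
  rw [entropy_eq_add_sum_klFun V s hlam]
  exact le_add_of_nonneg_right
    (Finset.sum_nonneg fun i _ => gibbs_mul_klFun_nonneg V s hlam i)

/-- Equality makes every relative-entropy term vanish, and `klFun` is zero only at `1`. -/
lemma eq_gibbs_of_entropy_eq (s : E n) {lam : Fin q → ℝ} (hlam : lam ∈ stdSimplex ℝ (Fin q))
    (h : entropy lam = ⟪s, ∑ i, lam i • V i⟫ - Real.log (partition V s)) : lam = gibbs V s := by
  rw [entropy_eq_add_sum_klFun V s hlam, add_eq_left,
    Finset.sum_eq_zero_iff_of_nonneg fun i _ => gibbs_mul_klFun_nonneg V s hlam i] at h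
  ext i
  have hg := gibbs_pos V s i
  have := (mul_eq_zero.1 (h i (Finset.mem_univ i))).resolve_left hg.ne'
  rw [InformationTheory.klFun_eq_zero_iff (div_nonneg (hlam.1 i) hg.le)] at this
  exact (div_eq_one_iff_eq hg.ne').1 this

lemma entropy_gibbs (s : E n) :
    entropy (gibbs V s) = ⟪s, gibbsMean V s⟫ - Real.log (partition V s) := by
  rw [entropy_eq_add_sum_klFun V s (gibbs_mem_stdSimplex V s)]
  simp [gibbsMean, div_self (gibbs_pos V s _).ne', InformationTheory.klFun_one]

end Gibbs

/-! ### The Legendre function as conjugate of the log-partition function -/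

section Legendre

variable (V : Fin q → E n)

lemma legendre_le_entropy {lam : Fin q → ℝ} (hlam : lam ∈ stdSimplex ℝ (Fin q)) :
    legendre V (∑ i, lam i • V i) ≤ entropy lam :=
  iInf₂_le lam (⟨hlam, rfl⟩ : lam ∈ stdSimplex ℝ (Fin q) ∧ _)

lemma continuous_sum_smul : Continuous fun lam : Fin q → ℝ => ∑ i, lam i • V i := by
  fun_prop

/-- The infimum that defines `legendre` is attained if it is finite. -/
lemma exists_entropy_eq_legendre {x : E n} (hx : legendre V x ≠ ⊤) :
    ∃ lam ∈ stdSimplex ℝ (Fin q), ∑ i, lam i • V i = x ∧ legendre V x = entropy lam := by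
  set S := {lam : Fin q → ℝ | lam ∈ stdSimplex ℝ (Fin q) ∧ ∑ i, lam i • V i = x}
  have hne : S.Nonempty := by
    by_contra h
    rw [Set.not_nonempty_iff_eq_empty] at h
    exact hx (by change ⨅ lam ∈ S, _ = _; simp [h])
  have hS : IsCompact S :=
    (isCompact_stdSimplex ℝ (Fin q)).inter_right
      (isClosed_singleton.preimage (continuous_sum_smul V))
  obtain ⟨lam, hlam, hmin⟩ := hS.exists_isMinOn hne continuous_entropy.continuousOn
  refine ⟨lam, hlam.1, hlam.2, le_antisymm (iInf₂_le lam hlam) ?_⟩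
  exact le_iInf₂ fun l hl => EReal.coe_le_coe_iff.2 (hmin hl)

/-- Sublevel sets below `⊤` are linear images of compact sets of weights, because the infimum is
attained. The level `⊤` is separate: its sublevel set is the whole space. -/
lemma measurable_legendre : Measurable (legendre V) := by
  refine measurable_of_Iic fun c => ?_
  rcases eq_or_ne c ⊤ with rfl | hc
  · simp
  have : legendre V ⁻¹' Iic c = (fun lam : Fin q → ℝ => ∑ i, lam i • V i) ''
      (stdSimplex ℝ (Fin q) ∩ {lam | (entropy lam : EReal) ≤ c}) := by
    ext x
    constructor
    · intro h
      obtain ⟨lam, h1, h2, h3⟩ :=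
        exists_entropy_eq_legendre V (ne_top_of_le_ne_top hc (mem_Iic.1 h))
      exact ⟨lam, ⟨h1, h3.symm.trans_le (mem_Iic.1 h)⟩, h2⟩
    · rintro ⟨lam, ⟨h1, h2⟩, rfl⟩
      exact (legendre_le_entropy V h1).trans h2
  rw [this]
  refine (IsCompact.image ?_ (continuous_sum_smul V)).measurableSet
  exact (isCompact_stdSimplex ℝ (Fin q)).inter_right
    (isClosed_Iic.preimage (continuous_coe_real_ereal.comp continuous_entropy))

lemma sum_smul_mem_polytope {lam : Fin q → ℝ} (hlam : lam ∈ stdSimplex ℝ (Fin q)) :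
    ∑ i, lam i • V i ∈ polytope V :=
  (convex_convexHull ℝ _).sum_mem (fun i _ => hlam.1 i) hlam.2
    fun i _ => subset_convexHull ℝ _ (mem_range_self i)

lemma mem_polytope_iff {x : E n} :
    x ∈ polytope V ↔ ∃ lam ∈ stdSimplex ℝ (Fin q), ∑ i, lam i • V i = x := by
  refine ⟨fun h => ?_, ?_⟩
  · have hc : Convex ℝ (Fintype.linearCombination ℝ V '' stdSimplex ℝ (Fin q)) :=
      (convex_stdSimplex ℝ _).linear_image _
    refine convexHull_min ?_ hc h
    rintro _ ⟨i, rfl⟩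
    exact ⟨Pi.single i 1, single_mem_stdSimplex ℝ i, by simp⟩
  · rintro ⟨lam, h, rfl⟩
    exact sum_smul_mem_polytope V h

lemma legendre_eq_toReal {x : E n} (hx : x ∈ polytope V) :
    legendre V x = ((legendre V x).toReal : EReal) := by
  obtain ⟨lam, h, rfl⟩ := (mem_polytope_iff V).1 hx
  have htop : legendre V (∑ i, lam i • V i) ≠ ⊤ :=
    ne_top_of_le_ne_top (EReal.coe_ne_top _) (legendre_le_entropy V h)
  obtain ⟨l, -, -, hl⟩ := exists_entropy_eq_legendre V htop
  rw [hl, EReal.toReal_coe]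

lemma abs_entropy_le {lam : Fin q → ℝ} (hlam : lam ∈ stdSimplex ℝ (Fin q)) :
    |entropy lam| ≤ q := by
  refine (Finset.abs_sum_le_sum_abs _ _).trans ?_
  refine (Finset.sum_le_card_nsmul _ _ 1 fun i _ => ?_).trans (by simp)
  have h1 : lam i ≤ 1 := hlam.2 ▸ Finset.single_le_sum (fun j _ => hlam.1 j) (Finset.mem_univ i)
  rcases (hlam.1 i).eq_or_lt with h0 | h0
  · simp [← h0]
  · rw [mul_comm]
    exact (Real.abs_log_mul_self_lt _ h0 h1).le

lemma abs_toReal_legendre_le {x : E n} (hx : x ∈ polytope V) : |(legendre V x).toReal| ≤ q := by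
  have h := legendre_eq_toReal V hx
  obtain ⟨l, hl, -, h'⟩ := exists_entropy_eq_legendre V (h ▸ EReal.coe_ne_top _)
  rw [h', EReal.toReal_coe]
  exact abs_entropy_le hl

variable [NeZero q]

/-- The Fenchel-Young inequality. -/
lemma inner_sub_log_partition_le_legendre (s x : E n) :
    ((⟪s, x⟫ - Real.log (partition V s) : ℝ) : EReal) ≤ legendre V x := by
  refine le_iInf₂ fun lam hlam => EReal.coe_le_coe_iff.2 ?_
  rw [← hlam.2]
  exact inner_sub_log_partition_le_entropy V s hlam.1

lemma legendre_gibbsMean (s : E n) :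
    legendre V (gibbsMean V s) = ((⟪s, gibbsMean V s⟫ - Real.log (partition V s) : ℝ) : EReal) := by
  refine le_antisymm ?_ (inner_sub_log_partition_le_legendre V s _)
  rw [← entropy_gibbs]
  exact legendre_le_entropy V (gibbs_mem_stdSimplex V s)

lemma eq_gibbsMean_of_legendre_eq {s x : E n}
    (h : legendre V x = ((⟪s, x⟫ - Real.log (partition V s) : ℝ) : EReal)) :
    x = gibbsMean V s := by
  obtain ⟨lam, h1, rfl, h3⟩ := exists_entropy_eq_legendre V (h ▸ EReal.coe_ne_top _)
  rw [h3, EReal.coe_eq_coe_iff] at h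
  rw [eq_gibbs_of_entropy_eq V s h1 h, gibbsMean]

variable {V}

/-- Equal weights make `s - t` have the same inner product with every vertex, hence with every point
of `P`. Moving from an interior point along `s - t` then forces `s = t`. -/
lemma gibbs_injective (hP : (interior (polytope V)).Nonempty) :
    Function.Injective (gibbs V) := by
  intro s t h
  have hi : ∀ i, ⟪s - t, V i⟫ = Real.log (partition V s) - Real.log (partition V t) := by
    intro i
    have := congrArg Real.log (congrFun h i)
    rw [log_gibbs, log_gibbs] at this
    rw [inner_sub_left]
    linarith
  have hx : ∀ x ∈ polytope V, ⟪s - t, x⟫ = Real.log (partition V s) - Real.log (partition V t) := by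
    intro x hx
    obtain ⟨lam, h1, rfl⟩ := (mem_polytope_iff V).1 hx
    simp only [inner_sum, inner_smul_right, hi, ← Finset.sum_mul, h1.2, one_mul]
  obtain ⟨p, hp⟩ := hP
  have hev : ∀ᶠ ε in nhds (0 : ℝ), p + ε • (s - t) ∈ polytope V := by
    have : Filter.Tendsto (fun ε : ℝ => p + ε • (s - t)) (nhds 0) (nhds p) := by
      have : Continuous (fun ε : ℝ => p + ε • (s - t)) := by fun_prop
      simpa using this.tendsto 0
    exact this (mem_interior_iff_mem_nhds.1 hp)
  obtain ⟨ε, hε, hε0⟩ :=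
    ((hev.filter_mono nhdsWithin_le_nhds).and (self_mem_nhdsWithin (s := {(0 : ℝ)}ᶜ))).exists
  have h1 := hx _ hε
  rw [inner_add_right, inner_smul_right, hx p (interior_subset hp), add_eq_left] at h1
  exact sub_eq_zero.1 (inner_self_eq_zero.1 ((mul_eq_zero.1 h1).resolve_left hε0))

/-- Testing a subgradient `t` at the point `gibbsMean V t` gives the reverse of Fenchel-Young for
`t` at `gibbsMean V s`. The equality case identifies the two Gibbs weight vectors. -/
lemma subdifferential_gibbsMean (hP : (interior (polytope V)).Nonempty) (s : E n) :
    subdifferential (legendre V) (gibbsMean V s) = {s} := by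
  ext t
  rw [mem_singleton_iff]
  constructor
  · intro ht
    have h1 := ht (gibbsMean V t)
    rw [legendre_gibbsMean, legendre_gibbsMean, ← EReal.coe_add, EReal.coe_le_coe_iff,
      inner_sub_right] at h1
    have h2 := inner_sub_log_partition_le_legendre V t (gibbsMean V s)
    rw [legendre_gibbsMean, EReal.coe_le_coe_iff] at h2
    have h3 : entropy (gibbs V s) = ⟪t, gibbsMean V s⟫ - Real.log (partition V t) := by
      rw [entropy_gibbs]; linarith
    exact (gibbs_injective hP (eq_gibbs_of_entropy_eq V t (gibbs_mem_stdSimplex V s) h3)).symm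
  · rintro rfl y
    refine le_trans (le_of_eq ?_) (inner_sub_log_partition_le_legendre V t y)
    rw [legendre_gibbsMean, ← EReal.coe_add, inner_sub_right]
    congr 1
    ring

lemma grad_gibbsMean (hP : (interior (polytope V)).Nonempty) (s : E n) :
    grad (legendre V) (gibbsMean V s) = s := by
  have h : ∃ t, subdifferential (legendre V) (gibbsMean V s) = {t} :=
    ⟨s, subdifferential_gibbsMean hP s⟩
  rw [grad, dif_pos h]
  exact singleton_injective (h.choose_spec.symm.trans (subdifferential_gibbsMean hP s))

/-- All weights are positive, so a small multiple of an interior point `p` can be split off, leaving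
a multiple of a point of `P`. -/
lemma gibbsMean_mem_interior (hP : (interior (polytope V)).Nonempty) (s : E n) :
    gibbsMean V s ∈ interior (polytope V) := by
  obtain ⟨p, hp⟩ := hP
  obtain ⟨lam, hlam, hsum⟩ := (mem_polytope_iff V).1 (interior_subset hp)
  obtain ⟨i₀, -, hmin⟩ := Finset.exists_min_image Finset.univ (gibbs V s) Finset.univ_nonempty
  set m := gibbs V s i₀
  have hm : 0 < m := gibbs_pos V s i₀
  -- The bound `m` keeps `gibbs V s i - ε * lam i` nonnegative; the bound `1 / 2` keeps `1 - ε`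
  -- positive.
  set ε := min m (1 / 2)
  have hε : 0 < ε := lt_min hm (by norm_num)
  have hε1 : 0 < 1 - ε := by linarith [min_le_right m (1 / 2)]
  set nu : Fin q → ℝ := fun i => (gibbs V s i - ε * lam i) / (1 - ε)
  have hnu : nu ∈ stdSimplex ℝ (Fin q) := by
    refine ⟨fun i => div_nonneg ?_ hε1.le, ?_⟩
    · have h1 : lam i ≤ 1 :=
        hlam.2 ▸ Finset.single_le_sum (fun j _ => hlam.1 j) (Finset.mem_univ i)
      have h2 := hmin i (Finset.mem_univ i)
      have h3 : ε * lam i ≤ ε := mul_le_of_le_one_right hε.le h1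
      linarith [min_le_left m (1 / 2)]
    · simp only [nu, ← Finset.sum_div, Finset.sum_sub_distrib, sum_gibbs, ← Finset.mul_sum, hlam.2]
      rw [mul_one, div_self hε1.ne']
  have heq : gibbsMean V s = ε • p + (1 - ε) • ∑ i, nu i • V i := by
    rw [← hsum, Finset.smul_sum, Finset.smul_sum, ← Finset.sum_add_distrib, gibbsMean]
    refine Finset.sum_congr rfl fun i _ => ?_
    rw [smul_smul, smul_smul, ← add_smul, mul_div_cancel₀ _ hε1.ne']
    congr 1
    ring
  rw [heq]
  exact (convex_convexHull ℝ _).combo_interior_self_mem_interior hp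
    (sum_smul_mem_polytope V hnu) hε hε1.le (by ring)

/-- Gibbs means over a bounded set of parameters stay uniformly away from the boundary. -/
lemma exists_le_infEDist_gibbsMean (hP : (interior (polytope V)).Nonempty) {C : ℝ} (hC : 0 ≤ C) :
    ∃ δ : ℝ≥0∞, 0 < δ ∧
      ∀ s : E n, ‖s‖ ≤ C → δ ≤ Metric.infEDist (gibbsMean V s) (frontier (polytope V)) := by
  obtain ⟨s₀, -, hmin⟩ := (isCompact_closedBall (0 : E n) C).exists_isMinOn
    (Metric.nonempty_closedBall.2 hC)
    ((Metric.continuous_infEDist (s := frontier (polytope V))).comp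
      (continuous_gibbsMean V)).continuousOn
  refine ⟨_, ?_, fun s hs => hmin (mem_closedBall_zero_iff.2 hs)⟩
  rw [pos_iff_ne_zero, Function.comp_apply, Ne,
    ← Metric.mem_iff_infEDist_zero_of_closed isClosed_frontier]
  exact disjoint_interior_frontier.notMem_of_mem_left (gibbsMean_mem_interior hP s₀)

end Legendre

/-! ### Integrals of extended real functions -/

section ExtIntegral

variable {X : Type*} [MeasurableSpace X] {μ : Measure X}

lemma extIntegral_mono {f g : X → EReal} (h : f ≤ᵐ[μ] g) : extIntegral μ f ≤ extIntegral μ g := by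
  refine EReal.sub_le_sub ?_ ?_
  · exact EReal.coe_ennreal_le_coe_ennreal_iff.2
      (lintegral_mono_ae (h.mono fun x hx => EReal.toENNReal_le_toENNReal hx))
  · exact EReal.coe_ennreal_le_coe_ennreal_iff.2
      (lintegral_mono_ae
        (h.mono fun x hx => EReal.toENNReal_le_toENNReal (EReal.neg_le_neg_iff.2 hx)))

lemma extIntegral_congr {f g : X → EReal} (h : f =ᵐ[μ] g) : extIntegral μ f = extIntegral μ g :=
  le_antisymm (extIntegral_mono h.le) (extIntegral_mono h.symm.le)

lemma lintegral_neg_toENNReal_lt_top {m : X → ℝ} (hm : Integrable m μ) {f : X → EReal}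
    (h : (fun x => (m x : EReal)) ≤ᵐ[μ] f) : ∫⁻ x, (-f x).toENNReal ∂μ < ∞ := by
  refine (lintegral_mono_ae (h.mono fun x hx => ?_)).trans_lt hm.neg.lintegral_lt_top
  exact EReal.toENNReal_le_toENNReal (EReal.neg_le_neg_iff.2 hx)

lemma extIntegral_coe {m : X → ℝ} (hm : Integrable m μ) :
    extIntegral μ (fun x => (m x : EReal)) = ((∫ x, m x ∂μ : ℝ) : EReal) := by
  rw [integral_eq_lintegral_pos_part_sub_lintegral_neg_part hm, EReal.coe_sub,
    EReal.coe_ennreal_toReal hm.lintegral_lt_top.ne,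
    EReal.coe_ennreal_toReal (by exact hm.neg.lintegral_lt_top.ne)]
  rfl

/-- A function above an integrable one with the same integral is almost everywhere equal to it. -/
lemma ae_eq_of_extIntegral_le {m : X → ℝ} (hm : Integrable m μ) {f : X → EReal}
    (hf : AEMeasurable f μ) (h : (fun x => (m x : EReal)) ≤ᵐ[μ] f)
    (hle : extIntegral μ f ≤ extIntegral μ fun x => (m x : EReal)) :
    (fun x => (m x : EReal)) =ᵐ[μ] f := by
  have hpos : (fun x => (m x : EReal).toENNReal) ≤ᵐ[μ] fun x => (f x).toENNReal :=
    h.mono fun x hx => EReal.toENNReal_le_toENNReal hx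
  have hneg : (fun x => (-f x).toENNReal) ≤ᵐ[μ] fun x => (-(m x : EReal)).toENNReal :=
    h.mono fun x hx => EReal.toENNReal_le_toENNReal (EReal.neg_le_neg_iff.2 hx)
  have hA := lintegral_mono_ae hpos
  have hB := lintegral_mono_ae hneg
  have hAt : ∫⁻ x, (m x : EReal).toENNReal ∂μ ≠ ∞ := hm.lintegral_lt_top.ne
  have hBt : ∫⁻ x, (-(m x : EReal)).toENNReal ∂μ ≠ ∞ := hm.neg.lintegral_lt_top.ne
  have hBt' := ne_top_of_le_ne_top hBt hB
  unfold extIntegral at hle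
  generalize hA0 : ∫⁻ x, (m x : EReal).toENNReal ∂μ = A at *
  generalize hB0 : ∫⁻ x, (-(m x : EReal)).toENNReal ∂μ = B at *
  generalize hA1 : ∫⁻ x, (f x).toENNReal ∂μ = A' at *
  generalize hB1 : ∫⁻ x, (-f x).toENNReal ∂μ = B' at *
  lift A to NNReal using hAt
  lift B to NNReal using hBt
  lift B' to NNReal using hBt'
  -- The negative part of `f` is already finite, so an infinite positive part would make its
  -- extended integral `⊤`.
  have hAt' : A' ≠ ∞ := by
    rintro rfl
    simp only [EReal.coe_ennreal_top, EReal.coe_nnreal_eq_coe_real] at hle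
    rw [EReal.top_sub_coe, ← EReal.coe_sub] at hle
    exact (EReal.coe_lt_top _).not_ge hle
  lift A' to NNReal using hAt'
  simp only [EReal.coe_nnreal_eq_coe_real, ← EReal.coe_sub, EReal.coe_le_coe_iff] at hle
  have hA' : (A : ℝ) ≤ A' := by exact_mod_cast hA
  have hB' : (B' : ℝ) ≤ B := by exact_mod_cast hB
  have hAA : A' ≤ A := by rw [← NNReal.coe_le_coe]; linarith
  have hBB : B ≤ B' := by rw [← NNReal.coe_le_coe]; linarith
  have e1 := ae_eq_of_ae_le_of_lintegral_le hpos (by rw [hA0]; exact ENNReal.coe_ne_top)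
    hf.ereal_toENNReal (by rw [hA0, hA1]; exact_mod_cast hAA)
  have e2 := ae_eq_of_ae_le_of_lintegral_le hneg (by rw [hB1]; exact ENNReal.coe_ne_top)
    hm.neg.aemeasurable.coe_real_ereal.ereal_toENNReal
    (by rw [hB1]; exact hB0.trans_le (by exact_mod_cast hBB))
  -- `toENNReal` truncates at zero, so the sign of `f x` decides which of the two equalities
  -- recovers the value.
  filter_upwards [e1, e2] with x h1 h2
  rcases le_total 0 (f x) with h0 | h0
  · have hx : 0 ≤ (m x : EReal) := by
      rw [EReal.toENNReal_of_nonpos (EReal.neg_le_zero.2 h0)] at h2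
      have := EReal.toENNReal_eq_zero_iff.1 h2.symm
      simpa using this
    exact (EReal.toENNReal_eq_toENNReal hx h0).1 h1
  · have hx : (m x : EReal) ≤ 0 := by
      rw [EReal.toENNReal_of_nonpos h0] at h1
      exact EReal.toENNReal_eq_zero_iff.1 h1
    exact neg_injective ((EReal.toENNReal_eq_toENNReal (EReal.neg_nonneg.2 h0)
      (EReal.neg_nonneg.2 hx)).1 h2).symm

end ExtIntegral

lemma exists_ae_norm_le {X G : Type*} [MeasurableSpace X] [NormedAddCommGroup G] {μ : Measure X}
    {f : X → G} (hf : MemLp f ∞ μ) : ∃ C, 0 ≤ C ∧ ∀ᵐ x ∂μ, ‖f x‖ ≤ C := by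
  refine ⟨(eLpNorm f ∞ μ).toReal, ENNReal.toReal_nonneg, ?_⟩
  filter_upwards [ae_le_eLpNormEssSup (f := f) (μ := μ)] with x hx
  rw [← eLpNorm_exponent_top, enorm_eq_nnnorm] at hx
  simpa using ENNReal.toReal_mono hf.eLpNorm_ne_top hx

/-! ### Pointwise minimization of the integrand -/

section Pointwise

variable {X : Type*} {n q : ℕ} (V : Fin q → E n) (α : ℝ) (g v : X → E n)

/-- The dual variable `∇R(v) - α g` of the mirror descent step. -/
def dualStep (x : X) : E n := grad (legendre V) (v x) - α • g x

/-- The part of the mirror descent integrand that does not depend on the competitor. -/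
def offset (x : X) : ℝ := ⟪grad (legendre V) (v x), v x⟫ - (legendre V (v x)).toReal

/-- The pointwise minimum of the mirror descent integrand. -/
def minIntegrand (x : X) : ℝ := offset V v x - Real.log (partition V (dualStep V α g v x))

variable {V v}

/-- On `P` the value `legendre V (v x)` is real, so the terms not involving `legendre V (η x)`
regroup as real numbers. -/
lemma integrand_eq {x : X} (hx : v x ∈ polytope V) (η : X → E n) :
    integrand (legendre V) α g v η x =
      legendre V (η x) + ((offset V v x - ⟪dualStep V α g v x, η x⟫ : ℝ) : EReal) := by
  rw [integrand, bregman, legendre_eq_toReal V hx, sub_eq_add_neg, sub_eq_add_neg, ← EReal.coe_neg,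
    ← EReal.coe_neg, add_assoc, ← EReal.coe_add, add_left_comm, ← EReal.coe_add]
  congr 2
  rw [offset, dualStep, inner_sub_left, inner_sub_right, real_inner_smul_left]
  ring

variable [NeZero q]

lemma minIntegrand_le {x : X} (hx : v x ∈ polytope V) (η : X → E n) :
    (minIntegrand V α g v x : EReal) ≤ integrand (legendre V) α g v η x := by
  rw [integrand_eq α g hx]
  refine le_trans (le_of_eq ?_) (add_le_add_left
    (inner_sub_log_partition_le_legendre V (dualStep V α g v x) (η x)) _)
  rw [← EReal.coe_add, minIntegrand]
  congr 1
  ring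

lemma integrand_of_eq_gibbsMean {x : X} (hx : v x ∈ polytope V) {η : X → E n}
    (h : η x = gibbsMean V (dualStep V α g v x)) :
    integrand (legendre V) α g v η x = minIntegrand V α g v x := by
  rw [integrand_eq α g hx, h, legendre_gibbsMean, ← EReal.coe_add, minIntegrand]
  congr 1
  ring

lemma eq_gibbsMean_of_integrand_eq {x : X} (hx : v x ∈ polytope V) {η : X → E n}
    (h : integrand (legendre V) α g v η x = minIntegrand V α g v x) :
    η x = gibbsMean V (dualStep V α g v x) := by
  refine eq_gibbsMean_of_legendre_eq V ?_
  rw [integrand_eq α g hx] at h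
  induction hR : legendre V (η x) with
  | bot => simp [hR] at h
  | top =>
    rw [hR, EReal.top_add_coe] at h
    exact absurd h (EReal.top_ne_coe _)
  | coe r =>
    rw [hR, ← EReal.coe_add, EReal.coe_eq_coe_iff, minIntegrand] at h
    rw [EReal.coe_eq_coe_iff]
    linarith

end Pointwise

/-! ### Measurability and bounds for the explicit minimizer -/

section Minimizer

variable {X : Type*} [MeasurableSpace X] {μ : Measure X} {n q : ℕ} {V : Fin q → E n} {α : ℝ}
  {g v : X → E n}

lemma memLp_dualStep (hg : MemLp g ∞ μ) (hgv : MemLp (fun x => grad (legendre V) (v x)) ∞ μ) :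
    MemLp (dualStep V α g v) ∞ μ := hgv.sub (hg.const_smul α)

lemma aemeasurable_integrand (hg : MemLp g ∞ μ) (hv : MemLp v ∞ μ)
    (hvP : ∀ᵐ x ∂μ, v x ∈ polytope V)
    (hgv : MemLp (fun x => grad (legendre V) (v x)) ∞ μ) {η : X → E n}
    (hη : AEStronglyMeasurable η μ) :
    AEMeasurable (integrand (legendre V) α g v η) μ := by
  have hR : ∀ {w : X → E n}, AEStronglyMeasurable w μ → AEMeasurable (fun x => legendre V (w x)) μ :=
    fun hw => (measurable_legendre V).comp_aemeasurable hw.aemeasurable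
  refine AEMeasurable.congr (f := fun x => legendre V (η x) +
    ((offset V v x - ⟪dualStep V α g v x, η x⟫ : ℝ) : EReal)) ?_
    (hvP.mono fun x hx => (integrand_eq α g hx η).symm)
  refine (hR hη).add (AEMeasurable.coe_real_ereal ?_)
  refine AEMeasurable.sub ?_ ((memLp_dualStep hg hgv).1.inner (𝕜 := ℝ) hη).aemeasurable
  exact (hgv.1.inner (𝕜 := ℝ) hv.1).aemeasurable.sub (hR hv.1).ereal_toReal

variable [NeZero q]

/-- Each of the three summands is essentially bounded and the measure is finite. -/
lemma integrable_minIntegrand [IsFiniteMeasure μ] (hg : MemLp g ∞ μ) (hv : MemLp v ∞ μ)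
    (hvP : ∀ᵐ x ∂μ, v x ∈ polytope V)
    (hgv : MemLp (fun x => grad (legendre V) (v x)) ∞ μ) :
    Integrable (minIntegrand V α g v) μ := by
  have hs : MemLp (dualStep V α g v) ∞ μ := memLp_dualStep hg hgv
  obtain ⟨C, -, hC⟩ := exists_ae_norm_le hs
  obtain ⟨C₁, -, hC₁⟩ := exists_ae_norm_le hv
  obtain ⟨C₂, hC₂0, hC₂⟩ := exists_ae_norm_le hgv
  obtain ⟨M, hM⟩ := (isCompact_closedBall (0 : E n) C).exists_bound_of_continuousOn
    (continuous_log_partition V).continuousOn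
  refine Integrable.sub (Integrable.sub ?_ ?_) ?_
  · refine Integrable.of_bound (hgv.1.inner (𝕜 := ℝ) hv.1) (C₂ * C₁) ?_
    filter_upwards [hC₁, hC₂] with x h1 h2
    exact (norm_inner_le_norm _ _).trans (mul_le_mul h2 h1 (norm_nonneg _) hC₂0)
  · refine Integrable.of_bound ((measurable_legendre V).comp_aemeasurable
      hv.1.aemeasurable).ereal_toReal.aestronglyMeasurable q ?_
    exact hvP.mono fun x hx => abs_toReal_legendre_le V hx
  · refine Integrable.of_bound ((continuous_log_partition V).comp_aestronglyMeasurable hs.1) M ?_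
    exact hC.mono fun x hx => hM _ (mem_closedBall_zero_iff.2 hx)

lemma memLp_gibbsMean_dualStep (hg : MemLp g ∞ μ)
    (hgv : MemLp (fun x => grad (legendre V) (v x)) ∞ μ) :
    MemLp (fun x => gibbsMean V (dualStep V α g v x)) ∞ μ := by
  have hs : MemLp (dualStep V α g v) ∞ μ := memLp_dualStep hg hgv
  obtain ⟨C, -, hC⟩ := exists_ae_norm_le hs
  obtain ⟨M, hM⟩ := (isCompact_closedBall (0 : E n) C).exists_bound_of_continuousOn
    (continuous_gibbsMean V).continuousOn
  refine memLp_top_of_bound ((continuous_gibbsMean V).comp_aestronglyMeasurable hs.1) M ?_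
  exact hC.mono fun x hx => hM _ (mem_closedBall_zero_iff.2 hx)

end Minimizer

end MirrorDescent

end

/-! ### The interior evolution theorem -/

open MirrorDescent in
theorem mainTheorem2
    {d n q r : ℕ} (hn : 1 ≤ n) (hnq : n < q)
    (Ω : Set (EuclideanSpace ℝ (Fin d))) (hΩ : MeasurableSet Ω) (hΩfin : volume Ω < ∞)
    (V : Fin q → E n) (hV : AreVertices V) (hP : (interior (polytope V)).Nonempty)
    (W : Matrix (Fin r) (Fin n) ℝ) (b : Fin r → ℝ)
    (F : Lp (E n) ∞ (volume.restrict Ω) → ℝ)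
    (gradF : Lp (E n) ∞ (volume.restrict Ω) → Lp (E n) ∞ (volume.restrict Ω))
    (hF : DifferentiableWithPrimalGradient (volume.restrict Ω)
      (setK (volume.restrict Ω) (polytope V) ∩ setM (volume.restrict Ω) W b) F gradF)
    (α : ℝ) (hα : 0 < α)
    (v : Lp (E n) ∞ (volume.restrict Ω))
    (hv : v ∈ setKint (volume.restrict Ω) (polytope V))
    (hgv : MemLp (fun x => grad (legendre V) (v x)) ∞ (volume.restrict Ω)) :
    -- the objective is well defined on all of `L¹`, with values in `ℝ ∪ {+∞}`
    (∀ η : Lp (E n) 1 (volume.restrict Ω),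
      AEMeasurable (integrand (legendre V) α (gradF v) v η) (volume.restrict Ω) ∧
      ∫⁻ x, (-integrand (legendre V) α (gradF v) v η x).toENNReal ∂(volume.restrict Ω) < ∞) ∧
    -- its minimum over `L¹` is finite and attained at exactly one point
    ∃ ηstar : Lp (E n) 1 (volume.restrict Ω),
      (∃ m : ℝ, objective (volume.restrict Ω) (legendre V) α (gradF v) v ηstar = (m : EReal)) ∧
      (∀ η : Lp (E n) 1 (volume.restrict Ω),
        objective (volume.restrict Ω) (legendre V) α (gradF v) v ηstar
          ≤ objective (volume.restrict Ω) (legendre V) α (gradF v) v η) ∧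
      (∀ η' : Lp (E n) 1 (volume.restrict Ω),
        (∀ η : Lp (E n) 1 (volume.restrict Ω),
          objective (volume.restrict Ω) (legendre V) α (gradF v) v η'
            ≤ objective (volume.restrict Ω) (legendre V) α (gradF v) v η) → η' = ηstar) ∧
      -- the minimizer is the class of an element of `L^∞` that is bounded away from the boundary
      ∃ ξ : Lp (E n) ∞ (volume.restrict Ω),
        ξ =ᵐ[volume.restrict Ω] ηstar ∧
        ξ ∈ setK (volume.restrict Ω) (polytope V) ∧
        ξ ∈ setKint (volume.restrict Ω) (polytope V) ∧
        MemLp (fun x => grad (legendre V) (ξ x)) ∞ (volume.restrict Ω) := by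
  have : NeZero q := ⟨by omega⟩
  have : IsFiniteMeasure (volume.restrict Ω) := isFiniteMeasure_restrict.2 hΩfin.ne
  have hg := Lp.memLp (gradF v)
  have hvL := Lp.memLp v
  have hvP : ∀ᵐ x ∂(volume.restrict Ω), v x ∈ polytope V := hv.1
  have hmeas : ∀ η : Lp (E n) 1 (volume.restrict Ω), AEMeasurable (integrand (legendre V) α (gradF v) v η) (volume.restrict Ω) :=
    fun η => aemeasurable_integrand hg hvL hvP hgv (Lp.aestronglyMeasurable η)
  have hint : Integrable (minIntegrand V α (gradF v) v) (volume.restrict Ω) :=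
    integrable_minIntegrand hg hvL hvP hgv
  have hle : ∀ η : Lp (E n) 1 (volume.restrict Ω), (fun x => (minIntegrand V α (gradF v) v x : EReal)) ≤ᵐ[volume.restrict Ω]
      integrand (legendre V) α (gradF v) v η :=
    fun η => hvP.mono fun x hx => minIntegrand_le α (gradF v) hx η
  have hξ : MemLp (fun x => gibbsMean V (dualStep V α (gradF v) v x)) ∞ (volume.restrict Ω) :=
    memLp_gibbsMean_dualStep hg hgv
  have hξ1 := hξ.mono_exponent (p := 1) le_top
  have hval : objective (volume.restrict Ω) (legendre V) α (gradF v) v (hξ1.toLp _) =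
      extIntegral (volume.restrict Ω) fun x => (minIntegrand V α (gradF v) v x : EReal) := by
    refine extIntegral_congr ?_
    filter_upwards [hvP, hξ1.coeFn_toLp] with x hx hx'
    exact integrand_of_eq_gibbsMean α (gradF v) hx hx'
  have hK : hξ.toLp _ ∈ setK (volume.restrict Ω) (polytope V) := by
    filter_upwards [hξ.coeFn_toLp] with x hx
    rw [hx]
    exact interior_subset (gibbsMean_mem_interior hP _)
  refine ⟨fun η => ⟨hmeas η, lintegral_neg_toENNReal_lt_top hint (hle η)⟩, hξ1.toLp _,
    ⟨_, hval.trans (extIntegral_coe hint)⟩, fun η => hval.trans_le (extIntegral_mono (hle η)),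
    fun η' hη' => ?_, hξ.toLp _, hξ.coeFn_toLp.trans hξ1.coeFn_toLp.symm, hK, ⟨hK, ?_⟩, ?_⟩
  -- A competing minimizer has integral at most that of the pointwise lower bound, so it attains
  -- this bound almost everywhere.
  · have h := ae_eq_of_extIntegral_le hint (hmeas η') (hle η') ((hη' _).trans_eq hval)
    refine Lp.ext ?_
    filter_upwards [h, hvP, hξ1.coeFn_toLp] with x h1 h2 h3
    rw [h3, eq_gibbsMean_of_integrand_eq α (gradF v) h2 h1.symm]
  · obtain ⟨C, hC0, hC⟩ := exists_ae_norm_le (memLp_dualStep (α := α) hg hgv)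
    obtain ⟨δ, hδ, hδle⟩ := exists_le_infEDist_gibbsMean hP hC0
    refine hδ.trans_le (le_essInf_of_ae_le δ ?_)
    filter_upwards [hC, hξ.coeFn_toLp] with x h1 h2
    rw [h2]
    exact hδle _ h1
  · refine (memLp_dualStep (α := α) hg hgv).ae_eq ?_
    filter_upwards [hξ.coeFn_toLp] with x hx
    rw [hx, grad_gibbsMean hP]
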